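/- Let $d\ge 1$ and let $(\Omega,\mathcal F)$ be a measurable space with a measurable flow $(\theta_s)_{s\in\mathbb R^d}$, i.e. $(\omega,s)\mapsto\theta_s\omega$ is measurable, $\theta_0=\mathrm{id}$ and $\theta_s\circ\theta_t=\theta_{s+t}$. Let $\mathbb P$ be a probability measure on $\Omega$ that is stationary (invariant under every $\theta_s$) and ergodic (every event invariant under all $\theta_s$ has probability $0$ or $1$). Let $\Phi,\Psi$ be ergodic random measures on $\mathbb R^d$, i.e. measurable maps $\omega\mapsto\Phi_\omega,\Psi_\omega$ from $\Omega$ to the locally finite Borel measures on $\mathbb R^d$ that are flow-adapted: $\Phi_{\theta_s\omega}(B)=\Phi_\omega(B+s)$ and $\Psi_{\theta_s\omega}(B)=\Psi_\omega(B+s)$ for all $s$, $\omega$ and Borel $B$. Suppose that their intensities $\lambda_\Phi,\lambda_\Psi$, defined by $\mathbb E[\Phi(B)]=\lambda_\Phi\,\mathrm{Leb}(B)$ and $\mathbb E[\Psi(B)]=\lambda_\Psi\,\mathrm{Leb}(B)$ for all Borel $B$, are positive and finite. For locally finite Borel measures $\varphi,\psi$ on $\mathbb R^d$, a measurable $f:\mathbb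 R^d\times\mathbb R^d\to[0,\infty)$ is a *sub-balancing density* if $\int f(x,\xi)\,\psi(d\xi)\le 1$ for all $x$ and $\int f(x,\xi)\,\varphi(dx)\le 1$ for all $\xi$. It is *balancing* if moreover equality holds for $\varphi$-a.e. $x$ and for $\psi$-a.e. $\xi$, and a sub-balancing density is *constrained* if $f\le 1$ everywhere. A point (site) $x\in\mathbb R^d$ is *exhausted* if $\int f(x,\xi)\,\psi(d\xi)=1$ and *unexhausted* otherwise; a point (center) $\xi\in\mathbb R^d$ is *sated* if $\int f(x,\xi)\,\varphi(dx)=1$ and *unsated* otherwise. A site $x_0$ *desires* a center $\xi_0$ if $f(x_0,\xi_0)<1$ and either $x_0$ is unexhausted or there is $\xi_1\in\mathbb R^d$ with $|x_0-\xi_1|>|x_0-\xi_0|$ and $f(x_0,\xi_1)>0$; symmetrically, $\xi_0$ *desires* $x_0$ if $f(x_0,\xi_0)<1$ and either $\xi_0$ is unsated or there is $x_1\in\mathbb R^d$ with $|x_1-\xi_0|>|x_0-\xi_0|$ and $f(x_1,\xi_0)>0$. A constrained density is *stable* if no pair $(x_0,\xi_0)\in\mathbb R^d\times\mathbb R^d$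 is such that $x_0$ desires $\xi_0$ and $\xi_0$ desires $x_0$. Let $F=F_\omega(x,\xi)$ be a real function, jointly measurable in $(\omega,x,\xi)$ and flow-adapted, i.e. $F_{\theta_s\omega}(x,\xi)=F_\omega(x+s,\xi+s)$, such that almost surely $F_\omega$ is a stable constrained density for $\Phi_\omega$ and $\Psi_\omega$. Then almost surely: 1. if $\lambda_\Phi=\lambda_\Psi$, then $F_\omega$ is balancing for $\Phi_\omega$ and $\Psi_\omega$, i.e. the set of unexhausted sites has zero $\Phi_\omega$-measure and the set of unsated centers has zero $\Psi_\omega$-measure; 2. if $\lambda_\Phi<\lambda_\Psi$, then there is no unexhausted site, but the set of unsated centers has infinite $\Psi_\omega$-measure; 3. if $\lambda_\Phi>\lambda_\Psi$, then there is no unsated center, but the set of unexhausted sites has infinite $\Phi_\omega$-measure. -/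

import Mathlib

open MeasureTheory
open scoped ENNReal

namespace StableTransport

/-- `ℝ^d` with the Euclidean distance and Lebesgue measure `volume`. -/
abbrev E (d : ℕ) : Type := EuclideanSpace ℝ (Fin d)

/-! ### Random measures

The measurable flow `θ_s` on `Ω` is an additive action of `ℝ^d` on `Ω`, `θ_s ω = s +ᵥ ω`, that is
jointly measurable in `(s, ω)` (`MeasurableVAdd₂`). -/

section Random

variable {d : ℕ} {Ω : Type*} [MeasurableSpace Ω] [AddAction (E d) Ω]

/-- The translated measure `θ_s φ`, given by `θ_s φ (B) = φ (B + s)`. -/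
noncomputable def shiftMeasure (s : E d) (φ : Measure (E d)) : Measure (E d) :=
  φ.map (fun x => x - s)

theorem shiftMeasure_apply (s : E d) (φ : Measure (E d)) {B : Set (E d)} (hB : MeasurableSet B) :
    shiftMeasure s φ B = φ ((fun x => x + s) '' B) := by
  rw [shiftMeasure, Measure.map_apply (by fun_prop) hB]
  congr 1
  ext x
  constructor
  · intro hx
    exact ⟨x - s, hx, by simp⟩
  · rintro ⟨y, hy, rfl⟩
    simpa using hy

/-- `P` is a stationary and ergodic probability measure: it is invariant under the flow, and every
event that is invariant under the whole flow has probability `0` or `1`. -/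
structure IsErgodic (d : ℕ) {Ω : Type*} [MeasurableSpace Ω] [AddAction (E d) Ω]
    (P : Measure Ω) : Prop where
  isProbabilityMeasure : IsProbabilityMeasure P
  stationary : ∀ s : E d, ∀ A : Set Ω, MeasurableSet A → P ((fun ω => s +ᵥ ω) ⁻¹' A) = P A
  ergodic : ∀ A : Set Ω, MeasurableSet A → (∀ s : E d, (fun ω => s +ᵥ ω) ⁻¹' A = A) →
    P A = 0 ∨ P A = 1

/-- `Φ` is a measurable flow-adapted map from `Ω` to the locally finite measures on `ℝ^d`
(with the σ-field generated by the evaluations `μ ↦ μ B`). -/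
structure IsFlowAdaptedMeasure (Φ : Ω → Measure (E d)) : Prop where
  locallyFinite : ∀ ω, IsLocallyFiniteMeasure (Φ ω)
  measurable : Measurable Φ
  flowAdapted : ∀ (s : E d) (ω : Ω), Φ (s +ᵥ ω) = shiftMeasure s (Φ ω)

/-- `(P, Φ)` is an ergodic (stationary) random measure. -/
structure IsErgodicRandomMeasure (P : Measure Ω) (Φ : Ω → Measure (E d)) : Prop where
  ergodic : IsErgodic d P
  flowAdapted : IsFlowAdaptedMeasure Φ

/-- `c` is the intensity of `(P, Φ)`: `𝔼[Φ(B)] = c · Leb(B)` for every Borel set `B`. -/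
def IsIntensity (P : Measure Ω) (Φ : Ω → Measure (E d)) (c : ℝ≥0∞) : Prop :=
  ∀ B : Set (E d), MeasurableSet B → ∫⁻ ω, Φ ω B ∂P = c * volume B

/-- `F = F_ω(x, ξ)` is a (jointly) measurable flow-adapted function:
`F_{θ_s ω}(x, ξ) = F_ω(x + s, ξ + s)`. -/
structure IsFlowAdaptedFunction (F : Ω → E d → E d → ℝ) : Prop where
  measurable : Measurable (fun p : Ω × E d × E d => F p.1 p.2.1 p.2.2)
  flowAdapted : ∀ (s : E d) (ω : Ω) (x ξ : E d), F (s +ᵥ ω) x ξ = F ω (x + s) (ξ + s)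

end Random

/-! ### Densities for a pair of measures `φ` (sites), `ψ` (centers) -/

section Density

variable {d : ℕ}

/-- The mass `∫ f(x, ξ) ψ(dξ)` sent out by the site `x`. -/
noncomputable def outMass (ψ : Measure (E d)) (f : E d → E d → ℝ) (x : E d) : ℝ≥0∞ :=
  ∫⁻ ξ, ENNReal.ofReal (f x ξ) ∂ψ

/-- The mass `∫ f(x, ξ) φ(dx)` received by the center `ξ`. -/
noncomputable def inMass (φ : Measure (E d)) (f : E d → E d → ℝ) (ξ : E d) : ℝ≥0∞ :=
  ∫⁻ x, ENNReal.ofReal (f x ξ) ∂φ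

structure IsSubBalancing (φ ψ : Measure (E d)) (f : E d → E d → ℝ) : Prop where
  measurable : Measurable (fun p : E d × E d => f p.1 p.2)
  nonneg : ∀ x ξ, 0 ≤ f x ξ
  outMass_le : ∀ x, outMass ψ f x ≤ 1
  inMass_le : ∀ ξ, inMass φ f ξ ≤ 1

structure IsBalancing (φ ψ : Measure (E d)) (f : E d → E d → ℝ) : Prop where
  subBalancing : IsSubBalancing φ ψ f
  outMass_eq : ∀ᵐ x ∂φ, outMass ψ f x = 1
  inMass_eq : ∀ᵐ ξ ∂ψ, inMass φ f ξ = 1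

structure IsConstrained (φ ψ : Measure (E d)) (f : E d → E d → ℝ) : Prop where
  subBalancing : IsSubBalancing φ ψ f
  le_one : ∀ x ξ, f x ξ ≤ 1

/-- The set of `f`-unexhausted points of `ℝ^d`. -/
def unexhausted (ψ : Measure (E d)) (f : E d → E d → ℝ) : Set (E d) :=
  {x | outMass ψ f x ≠ 1}

/-- The set of `f`-unsated points of `ℝ^d`. -/
def unsated (φ : Measure (E d)) (f : E d → E d → ℝ) : Set (E d) :=
  {ξ | inMass φ f ξ ≠ 1}

/-- The site `x₀` desires the center `ξ₀`. -/
def SiteDesires (ψ : Measure (E d)) (f : E d → E d → ℝ) (x₀ ξ₀ : E d) : Prop :=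
  f x₀ ξ₀ < 1 ∧ (x₀ ∈ unexhausted ψ f ∨ ∃ ξ₁, dist x₀ ξ₀ < dist x₀ ξ₁ ∧ 0 < f x₀ ξ₁)

/-- The center `ξ₀` desires the site `x₀`. -/
def CenterDesires (φ : Measure (E d)) (f : E d → E d → ℝ) (ξ₀ x₀ : E d) : Prop :=
  f x₀ ξ₀ < 1 ∧ (ξ₀ ∈ unsated φ f ∨ ∃ x₁, dist x₀ ξ₀ < dist x₁ ξ₀ ∧ 0 < f x₁ ξ₀)

/-- `f` is a stable constrained density for `φ` and `ψ`. -/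
structure IsStableConstrained (φ ψ : Measure (E d)) (f : E d → E d → ℝ) : Prop where
  constrained : IsConstrained φ ψ f
  stable : ¬ ∃ x₀ ξ₀ : E d, SiteDesires ψ f x₀ ξ₀ ∧ CenterDesires φ f ξ₀ x₀

end Density

end StableTransport

open StableTransport

/-! Three facts carry the proof. First, the `Φ`-mass of the unexhausted sites is almost surely `0`
or almost surely `∞`: normalising finite nonzero masses and averaging would give a nonzero finite
translation-invariant measure on `ℝ^d`, and ergodicity makes the alternative deterministic
(`ae_measure_unexhausted_eq_zero_or_ae_eq_top`). Second, stability gives every unsated center the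
full value `f = 1` at all unexhausted sites, so infinite mass of unexhausted sites leaves no unsated
center (`IsStableConstrained.unsated_eq_empty`). Third, by mass transport the mean mass sent from a
bounded set equals the mean mass received in it (`lintegral_outMass_eq_lintegral_inMass`); intensity
times volume is this common value plus the mean deficit. If `λ_Φ > λ_Ψ`, the deficit of the sites
cannot vanish, so their unexhausted mass is `∞`. If the intensities agree and that mass were `∞`,
the centers would have no deficit, hence neither would the sites. The remaining claims follow by
exchanging sites and centers. -/

open ProbabilityTheory

namespace StableTransport

/-! ### Kernels of locally finite measures are s-finite -/

/-- The total masses need not be uniformly bounded, so the parameter space is cut according to their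
integer part; each piece is a finite kernel. -/
theorem isSFiniteKernel_of_forall_isFiniteMeasure {α β : Type*} [MeasurableSpace α]
    [MeasurableSpace β] (κ : Kernel α β) (h : ∀ a, IsFiniteMeasure (κ a)) :
    IsSFiniteKernel κ := by
  classical
  have hm (k : ℕ) : MeasurableSet {a | ⌊(κ a Set.univ).toReal⌋₊ = k} :=
    (Nat.measurable_floor.comp (κ.measurable_coe MeasurableSet.univ).ennreal_toReal)
      (measurableSet_singleton k)
  have hfin (k : ℕ) : IsFiniteKernel (Kernel.piecewise (hm k) κ 0) := by
    refine ⟨⟨k + 1, by simp, fun a => ?_⟩⟩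
    rw [Kernel.piecewise_apply]
    split_ifs with ha
    · have := h a
      rw [← ENNReal.ofReal_toReal (measure_ne_top (κ a) Set.univ)]
      have h1 : (κ a Set.univ).toReal ≤ ((k + 1 : ℕ) : ℝ) := by
        have := Nat.lt_floor_add_one (κ a Set.univ).toReal
        rw [show ⌊(κ a Set.univ).toReal⌋₊ = k from ha] at this
        push_cast
        exact this.le
      refine (ENNReal.ofReal_le_ofReal h1).trans_eq ?_
      rw [ENNReal.ofReal_natCast]
      push_cast
      rfl
    · simp
  refine ⟨fun k => Kernel.piecewise (hm k) κ 0, hfin, ?_⟩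
  ext a s hs
  rw [Kernel.sum_apply' _ _ hs, tsum_eq_single ⌊(κ a Set.univ).toReal⌋₊]
  · simp [Kernel.piecewise_apply]
  · intro k hk
    simp [Kernel.piecewise_apply, hk.symm]

/-- Cutting `ℝ^d` into the bounded shells `n ≤ ‖x‖ < n + 1` reduces this to finite measures. It
supplies the measurability and Fubini arguments for random measures. -/
theorem isSFiniteKernel_of_forall_isLocallyFiniteMeasure {d : ℕ} {α : Type*} [MeasurableSpace α]
    (κ : Kernel α (E d)) (h : ∀ a, IsLocallyFiniteMeasure (κ a)) : IsSFiniteKernel κ := by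
  let B (n : ℕ) : Set (E d) := {x | ⌊‖x‖⌋₊ = n}
  have hB (n : ℕ) : MeasurableSet (B n) :=
    (Nat.measurable_floor.comp measurable_norm) (measurableSet_singleton n)
  have hs (n : ℕ) : IsSFiniteKernel (κ.restrict (hB n)) := by
    refine isSFiniteKernel_of_forall_isFiniteMeasure _ fun a => ⟨?_⟩
    rw [Kernel.restrict_apply, Measure.restrict_apply_univ]
    have := h a
    refine (measure_mono ?_).trans_lt
      (measure_closedBall_lt_top (μ := κ a) (x := (0 : E d)) (r := n + 1))
    intro x hx
    have h1 := Nat.lt_floor_add_one ‖x‖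
    have hx' : ⌊‖x‖⌋₊ = n := hx
    rw [hx'] at h1
    simpa using h1.le
  have hκ : κ = Kernel.sum fun n => κ.restrict (hB n) := by
    ext1 a
    rw [Kernel.sum_apply]
    simp only [Kernel.restrict_apply]
    rw [← Measure.restrict_iUnion _ hB]
    · have : ⋃ n, B n = Set.univ := Set.eq_univ_of_forall fun x => Set.mem_iUnion.2 ⟨_, rfl⟩
      rw [this, Measure.restrict_univ]
    · intro m n hmn
      refine Set.disjoint_left.2 fun x hx hx' => hmn ?_
      exact (show ⌊‖x‖⌋₊ = m from hx).symm.trans hx'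
  rw [hκ]
  exact Kernel.isSFiniteKernel_sum

/-! ### Invariant measures -/

/-- A nonzero invariant measure has infinite total mass on a noncompact group; `d ≥ 1` provides
noncompactness. -/
theorem eq_zero_of_isFiniteMeasure_of_isAddLeftInvariant {d : ℕ} (hd : 1 ≤ d) (m : Measure (E d))
    [IsFiniteMeasure m] [m.IsAddLeftInvariant] : m = 0 := by
  by_contra h0
  have : NeZero m := ⟨h0⟩
  have : Nonempty (Fin d) := ⟨⟨0, hd⟩⟩
  have : Nontrivial (E d) := inferInstance
  have : NoncompactSpace (E d) := NormedSpace.noncompactSpace ℝ (E d)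
  have : m.IsOpenPosMeasure := isOpenPosMeasure_of_addLeftInvariant_of_regular
  exact measure_ne_top m Set.univ (measure_univ_of_isAddLeftInvariant m)

/-- The mass transport principle for a diagonally invariant measure on `ℝ^d × ℝ^d`. -/
theorem measure_fst_preimage_eq_of_diagonal_invariant {d : ℕ} (M : Measure (E d × E d)) [SFinite M]
    (hM : ∀ (s : E d) (H : E d × E d → ℝ≥0∞), Measurable H →
      ∫⁻ p, H (p.1 + s, p.2 + s) ∂M = ∫⁻ p, H p ∂M)
    {B : Set (E d)} (hB : MeasurableSet B) (h0 : volume B ≠ 0) (htop : volume B ≠ ∞) :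
    M (Prod.fst ⁻¹' B) = M (Prod.snd ⁻¹' B) := by
  let i : E d → ℝ≥0∞ := B.indicator 1
  have hi : Measurable i := measurable_one.indicator hB
  have hvol : ∫⁻ s, i s = volume B := lintegral_indicator_one hB
  have h1 (y : E d) : ∫⁻ s, i (y + s) = volume B := by
    rw [lintegral_add_left_eq_self, hvol]
  have h2 (y : E d) : ∫⁻ s, i (y - s) = volume B := by
    rw [lintegral_sub_left_eq_self, hvol]
  have hfst : ∫⁻ p, i p.1 ∂M = M (Prod.fst ⁻¹' B) :=
    lintegral_indicator_one (measurable_fst hB)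
  have hsnd : ∫⁻ p, i p.2 ∂M = M (Prod.snd ⁻¹' B) :=
    lintegral_indicator_one (measurable_snd hB)
  have key : M (Prod.fst ⁻¹' B) * volume B = M (Prod.snd ⁻¹' B) * volume B := by
    calc M (Prod.fst ⁻¹' B) * volume B
        = ∫⁻ p, (∫⁻ s, i p.1 * i (p.2 + s)) ∂M := by
          rw [← hfst, ← lintegral_mul_const _ (by fun_prop)]
          refine lintegral_congr fun p => ?_
          rw [lintegral_const_mul _ (by fun_prop), h1]
      _ = ∫⁻ s, ∫⁻ p, i p.1 * i (p.2 + s) ∂M :=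
          lintegral_lintegral_swap (by unfold Function.uncurry; fun_prop)
      -- For fixed `s`, diagonal invariance moves the shift from the second coordinate to the first.
      _ = ∫⁻ s, ∫⁻ p, i (p.1 - s) * i p.2 ∂M := by
          refine lintegral_congr fun s => ?_
          rw [← hM s (fun p => i (p.1 - s) * i p.2) (by fun_prop)]
          simp
      _ = ∫⁻ p, (∫⁻ s, i (p.1 - s) * i p.2) ∂M :=
          (lintegral_lintegral_swap (by unfold Function.uncurry; fun_prop)).symm
      _ = M (Prod.snd ⁻¹' B) * volume B := by
          rw [← hsnd, ← lintegral_mul_const _ (by fun_prop)]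
          refine lintegral_congr fun p => ?_
          rw [lintegral_mul_const _ (by fun_prop), h2, mul_comm]
  exact (ENNReal.mul_left_inj h0 htop).1 key

/-! ### Flow-adapted measures and functions -/

section Flow

variable {d : ℕ} {Ω : Type*} [MeasurableSpace Ω] [AddAction (E d) Ω] {P : Measure Ω}
  {Φ Ψ : Ω → Measure (E d)} {F : Ω → E d → E d → ℝ}

theorem lintegral_shiftMeasure (s : E d) (φ : Measure (E d)) {g : E d → ℝ≥0∞}
    (hg : Measurable g) : ∫⁻ x, g x ∂shiftMeasure s φ = ∫⁻ x, g (x - s) ∂φ :=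
  lintegral_map hg (by fun_prop)

theorem IsErgodic.lintegral_vadd [MeasurableVAdd₂ (E d) Ω] (hP : IsErgodic d P) (s : E d)
    {g : Ω → ℝ≥0∞} (hg : Measurable g) : ∫⁻ ω, g (s +ᵥ ω) ∂P = ∫⁻ ω, g ω ∂P := by
  have hs : Measurable fun ω : Ω => s +ᵥ ω := measurable_const_vadd s
  have hmap : P.map (fun ω => s +ᵥ ω) = P := by
    ext A hA
    rw [Measure.map_apply hs hA, hP.stationary s A hA]
  conv_rhs => rw [← hmap]
  rw [lintegral_map hg hs]

/-- A stationary random measure has total mass `0` or `∞` almost surely. -/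
theorem ae_measure_univ_eq_zero_or_top [MeasurableVAdd₂ (E d) Ω] (hd : 1 ≤ d)
    (hP : IsErgodic d P) {μ : Ω → Measure (E d)} (hμ : Measurable μ)
    (hadapt : ∀ (s : E d) (ω : Ω), μ (s +ᵥ ω) = shiftMeasure s (μ ω)) :
    ∀ᵐ ω ∂P, μ ω Set.univ = 0 ∨ μ ω Set.univ = ∞ := by
  have := hP.isProbabilityMeasure
  have hcoe {B : Set (E d)} (hB : MeasurableSet B) : Measurable fun ω => μ ω B :=
    (Measure.measurable_coe hB).comp hμ
  -- With `∞⁻¹ = 0`, this is a probability measure when the total mass is positive and finite, and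
  -- zero otherwise. Its mean is finite and translation invariant, hence zero.
  let κ : Ω → Measure (E d) := fun ω => (μ ω Set.univ)⁻¹ • μ ω
  have hκ : Measurable κ := by
    refine Measure.measurable_of_measurable_coe _ fun B hB => ?_
    exact (hcoe MeasurableSet.univ).inv.mul (hcoe hB)
  have hbind {B : Set (E d)} (hB : MeasurableSet B) :
      (P.bind κ) B = ∫⁻ ω, κ ω B ∂P := Measure.bind_apply hB hκ.aemeasurable
  have hfin : IsFiniteMeasure (P.bind κ) := by
    refine ⟨?_⟩
    rw [hbind MeasurableSet.univ]
    calc ∫⁻ ω, κ ω Set.univ ∂P ≤ ∫⁻ _, 1 ∂P :=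
          lintegral_mono fun ω => ENNReal.inv_mul_le_one _
      _ < ∞ := by simp
  have hinv : (P.bind κ).IsAddLeftInvariant := by
    refine ⟨fun s => ?_⟩
    ext B hB
    rw [Measure.map_apply (by fun_prop) hB, hbind hB,
      hbind (measurable_const_add s hB),
      ← hP.lintegral_vadd (-s) (g := fun ω => κ ω B) ((Measure.measurable_coe hB).comp hκ)]
    refine lintegral_congr fun ω => ?_
    simp only [κ, hadapt, Measure.smul_apply, shiftMeasure]
    rw [Measure.map_apply (by fun_prop) hB, Measure.map_apply (by fun_prop) MeasurableSet.univ]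
    simp only [sub_neg_eq_add, Set.preimage_univ, add_comm]
  have hzero := eq_zero_of_isFiniteMeasure_of_isAddLeftInvariant hd (P.bind κ)
  have h0 : ∫⁻ ω, κ ω Set.univ ∂P = 0 := by rw [← hbind MeasurableSet.univ, hzero]; rfl
  have hκ1 : Measurable fun ω => κ ω Set.univ :=
    (Measure.measurable_coe MeasurableSet.univ).comp hκ
  rw [lintegral_eq_zero_iff hκ1] at h0
  filter_upwards [h0] with ω hω
  have : (μ ω Set.univ)⁻¹ * μ ω Set.univ = 0 := hω
  rcases mul_eq_zero.1 this with h | h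
  · exact Or.inr (ENNReal.inv_eq_zero.1 h)
  · exact Or.inl h

/-- The kernel `ω ↦ Φ_ω` of a flow-adapted random measure. -/
def IsFlowAdaptedMeasure.kernel (hΦ : IsFlowAdaptedMeasure Φ) : Kernel Ω (E d) :=
  ⟨Φ, hΦ.measurable⟩

instance IsFlowAdaptedMeasure.isSFiniteKernel_kernel (hΦ : IsFlowAdaptedMeasure Φ) :
    IsSFiniteKernel hΦ.kernel :=
  isSFiniteKernel_of_forall_isLocallyFiniteMeasure _ hΦ.locallyFinite

theorem IsFlowAdaptedMeasure.measurable_lintegral (hΦ : IsFlowAdaptedMeasure Φ) {α : Type*}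
    [MeasurableSpace α] {a : α → Ω} (ha : Measurable a) {g : α → E d → ℝ≥0∞}
    (hg : Measurable (Function.uncurry g)) : Measurable fun p => ∫⁻ x, g p x ∂Φ (a p) :=
  Measurable.lintegral_kernel_prod_right (κ := hΦ.kernel.comap a ha) hg

theorem IsFlowAdaptedFunction.swap (hF : IsFlowAdaptedFunction F) :
    IsFlowAdaptedFunction fun ω ξ x => F ω x ξ where
  measurable := hF.measurable.comp
    (f := fun p : Ω × E d × E d => (p.1, p.2.2, p.2.1)) (by fun_prop)
  flowAdapted s ω x ξ := hF.flowAdapted s ω ξ x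

theorem measurable_outMass (hΨ : IsFlowAdaptedMeasure Ψ) (hF : IsFlowAdaptedFunction F) :
    Measurable fun p : Ω × E d => outMass (Ψ p.1) (F p.1) p.2 := by
  refine hΨ.measurable_lintegral measurable_fst (ENNReal.measurable_ofReal.comp ?_)
  exact hF.measurable.comp (f := fun q : (Ω × E d) × E d => (q.1.1, q.1.2, q.2)) (by fun_prop)

theorem outMass_vadd (hΨ : IsFlowAdaptedMeasure Ψ) (hF : IsFlowAdaptedFunction F) (s : E d)
    (ω : Ω) (x : E d) :
    outMass (Ψ (s +ᵥ ω)) (F (s +ᵥ ω)) x = outMass (Ψ ω) (F ω) (x + s) := by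
  have hm : Measurable fun ξ => ENNReal.ofReal (F (s +ᵥ ω) x ξ) :=
    ENNReal.measurable_ofReal.comp
      (hF.measurable.comp (f := fun ξ : E d => (s +ᵥ ω, x, ξ)) (by fun_prop))
  rw [outMass, hΨ.flowAdapted, lintegral_shiftMeasure _ _ hm]
  simp [outMass, hF.flowAdapted]

theorem measurableSet_unexhausted (hΨ : IsFlowAdaptedMeasure Ψ) (hF : IsFlowAdaptedFunction F)
    (ω : Ω) : MeasurableSet (unexhausted (Ψ ω) (F ω)) :=
  ((measurable_outMass hΨ hF).comp (measurable_prodMk_left (x := ω)))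
    (measurableSet_singleton 1).compl

theorem measurable_restrict_unexhausted (hΦ : IsFlowAdaptedMeasure Φ)
    (hΨ : IsFlowAdaptedMeasure Ψ) (hF : IsFlowAdaptedFunction F) :
    Measurable fun ω => (Φ ω).restrict (unexhausted (Ψ ω) (F ω)) := by
  refine Measure.measurable_of_measurable_coe _ fun B hB => ?_
  simp only [Measure.restrict_apply hB]
  refine Kernel.measurable_kernel_prodMk_left (κ := hΦ.kernel)
    (t := Prod.snd ⁻¹' B ∩ {p | outMass (Ψ p.1) (F p.1) p.2 ≠ 1}) ?_
  exact (measurable_snd hB).inter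
    ((measurable_outMass hΨ hF) (measurableSet_singleton 1).compl)

theorem restrict_unexhausted_vadd (hΦ : IsFlowAdaptedMeasure Φ)
    (hΨ : IsFlowAdaptedMeasure Ψ) (hF : IsFlowAdaptedFunction F) (s : E d) (ω : Ω) :
    (Φ (s +ᵥ ω)).restrict (unexhausted (Ψ (s +ᵥ ω)) (F (s +ᵥ ω))) =
      shiftMeasure s ((Φ ω).restrict (unexhausted (Ψ ω) (F ω))) := by
  rw [hΦ.flowAdapted, shiftMeasure, shiftMeasure,
    Measure.restrict_map (by fun_prop) (measurableSet_unexhausted hΨ hF _)]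
  congr 2
  ext x
  simp [unexhausted, outMass_vadd hΨ hF]

theorem measurable_measure_unexhausted (hΦ : IsFlowAdaptedMeasure Φ)
    (hΨ : IsFlowAdaptedMeasure Ψ) (hF : IsFlowAdaptedFunction F) :
    Measurable fun ω => Φ ω (unexhausted (Ψ ω) (F ω)) := by
  simpa [Function.comp_def] using (Measure.measurable_coe MeasurableSet.univ).comp
    (measurable_restrict_unexhausted hΦ hΨ hF)

theorem measure_unexhausted_vadd (hΦ : IsFlowAdaptedMeasure Φ)
    (hΨ : IsFlowAdaptedMeasure Ψ) (hF : IsFlowAdaptedFunction F) (s : E d) (ω : Ω) :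
    Φ (s +ᵥ ω) (unexhausted (Ψ (s +ᵥ ω)) (F (s +ᵥ ω))) = Φ ω (unexhausted (Ψ ω) (F ω)) := by
  have := DFunLike.congr_fun (restrict_unexhausted_vadd hΦ hΨ hF s ω) Set.univ
  rw [shiftMeasure, Measure.map_apply (by fun_prop) MeasurableSet.univ] at this
  simpa using this

/-- By ergodicity, the mass of the unexhausted sites is either almost surely `0` or almost surely
`∞`. -/
theorem ae_measure_unexhausted_eq_zero_or_ae_eq_top [MeasurableVAdd₂ (E d) Ω] (hd : 1 ≤ d)
    (hP : IsErgodic d P) (hΦ : IsFlowAdaptedMeasure Φ) (hΨ : IsFlowAdaptedMeasure Ψ)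
    (hF : IsFlowAdaptedFunction F) :
    (∀ᵐ ω ∂P, Φ ω (unexhausted (Ψ ω) (F ω)) = 0) ∨
      ∀ᵐ ω ∂P, Φ ω (unexhausted (Ψ ω) (F ω)) = ∞ := by
  have := hP.isProbabilityMeasure
  have h := ae_measure_univ_eq_zero_or_top hd hP (measurable_restrict_unexhausted hΦ hΨ hF)
    (restrict_unexhausted_vadd hΦ hΨ hF)
  simp only [Measure.restrict_apply_univ] at h
  have hA : MeasurableSet {ω | Φ ω (unexhausted (Ψ ω) (F ω)) = ∞} :=
    measurable_measure_unexhausted hΦ hΨ hF (measurableSet_singleton ∞)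
  -- Having infinite unexhausted mass is a flow-invariant event.
  rcases hP.ergodic _ hA fun s => by
    ext ω; simp [measure_unexhausted_vadd hΦ hΨ hF] with h0 | h1
  · left
    filter_upwards [h, measure_eq_zero_iff_ae_notMem.1 h0] with ω h1 h2
    exact h1.resolve_right h2
  · right
    exact (prob_compl_eq_zero_iff hA).2 h1

/-- The mass transport principle for a flow-adapted density. -/
theorem lintegral_outMass_eq_lintegral_inMass [MeasurableVAdd₂ (E d) Ω]
    (hP : IsErgodic d P) (hΦ : IsFlowAdaptedMeasure Φ) (hΨ : IsFlowAdaptedMeasure Ψ)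
    (hF : IsFlowAdaptedFunction F) {B : Set (E d)} (hB : MeasurableSet B)
    (h0 : volume B ≠ 0) (htop : volume B ≠ ∞) :
    ∫⁻ ω, ∫⁻ x in B, outMass (Ψ ω) (F ω) x ∂Φ ω ∂P =
      ∫⁻ ω, ∫⁻ ξ in B, inMass (Φ ω) (F ω) ξ ∂Ψ ω ∂P := by
  have := hP.isProbabilityMeasure
  let f : Ω × E d × E d → ℝ≥0∞ := fun p => ENNReal.ofReal (F p.1 p.2.1 p.2.2)
  have hf : Measurable f := ENNReal.measurable_ofReal.comp hF.measurable
  -- The mean transport measure `𝔼[F(x, ξ) Φ(dx) Ψ(dξ)]`; its mass over `B` in the first coordinate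
  -- is the mean mass sent from `B`, in the second the mean mass received in `B`.
  let M : Measure (E d × E d) :=
    ((P ⊗ₘ (hΦ.kernel ×ₖ hΨ.kernel)).withDensity f).map Prod.snd
  have hM {H : E d × E d → ℝ≥0∞} (hH : Measurable H) :
      ∫⁻ p, H p ∂M = ∫⁻ ω, ∫⁻ x, ∫⁻ ξ, f (ω, x, ξ) * H (x, ξ) ∂Ψ ω ∂Φ ω ∂P := by
    rw [lintegral_map hH measurable_snd,
      lintegral_withDensity_eq_lintegral_mul _ hf (g := fun p => H p.2) (by fun_prop),
      Measure.lintegral_compProd (by fun_prop)]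
    refine lintegral_congr fun ω => ?_
    rw [Kernel.lintegral_prod _ _ _ (by fun_prop)]
    rfl
  have hinv (s : E d) (H : E d × E d → ℝ≥0∞) (hH : Measurable H) :
      ∫⁻ p, H (p.1 + s, p.2 + s) ∂M = ∫⁻ p, H p ∂M := by
    have h3 : Measurable fun q : (Ω × E d) × E d => f (q.1.1, q.1.2, q.2) * H (q.1.2, q.2) := by
      fun_prop
    have h2 : Measurable fun q : Ω × E d =>
        ∫⁻ ξ, f (q.1, q.2, ξ) * H (q.2, ξ) ∂Ψ q.1 :=
      hΨ.measurable_lintegral measurable_fst h3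
    have h1 : Measurable fun ω => ∫⁻ x, ∫⁻ ξ, f (ω, x, ξ) * H (x, ξ) ∂Ψ ω ∂Φ ω :=
      hΦ.measurable_lintegral measurable_id h2
    rw [hM hH, hM (H := fun p => H (p.1 + s, p.2 + s)) (by fun_prop),
      ← hP.lintegral_vadd (-s) h1]
    refine lintegral_congr fun ω => ?_
    rw [hΦ.flowAdapted, lintegral_shiftMeasure]
    · refine lintegral_congr fun x => ?_
      rw [hΨ.flowAdapted, lintegral_shiftMeasure _ _ (by fun_prop)]
      simp [f, hF.flowAdapted]
    · exact h2.comp (measurable_prodMk_left (x := -s +ᵥ ω))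
  have key := measure_fst_preimage_eq_of_diagonal_invariant M hinv hB h0 htop
  rw [← lintegral_indicator_one (measurable_fst hB),
    ← lintegral_indicator_one (measurable_snd hB),
    hM (measurable_one.indicator (measurable_fst hB)),
    hM (measurable_one.indicator (measurable_snd hB))] at key
  refine Eq.trans ?_ (key.trans ?_)
  · refine lintegral_congr fun ω => ?_
    rw [← lintegral_indicator hB]
    refine lintegral_congr fun x => ?_
    by_cases hx : x ∈ B <;> simp [hx, outMass, f]
  · refine lintegral_congr fun ω => ?_
    have := hΦ.locallyFinite ω
    have := hΨ.locallyFinite ω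
    rw [← lintegral_indicator hB, lintegral_lintegral_swap]
    · refine lintegral_congr fun x => ?_
      by_cases hx : x ∈ B <;> simp [hx, inMass, f]
    · have h1 : Measurable ((Prod.snd ⁻¹' B : Set (E d × E d)).indicator
          (1 : E d × E d → ℝ≥0∞)) :=
        measurable_one.indicator (measurable_snd hB)
      unfold Function.uncurry
      fun_prop

/-- The expected mass of `Φ` in `B` splits into the mass sent out and the deficit of the sites. -/
theorem lintegral_outMass_add_deficit (hΦ : IsFlowAdaptedMeasure Φ) (hΨ : IsFlowAdaptedMeasure Ψ)
    (hF : IsFlowAdaptedFunction F) (hle : ∀ᵐ ω ∂P, ∀ x, outMass (Ψ ω) (F ω) x ≤ 1)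
    {c : ℝ≥0∞} (hc : IsIntensity P Φ c) {B : Set (E d)} (hB : MeasurableSet B) :
    ∫⁻ ω, ∫⁻ x in B, outMass (Ψ ω) (F ω) x ∂Φ ω ∂P +
      ∫⁻ ω, ∫⁻ x in B, (1 - outMass (Ψ ω) (F ω) x) ∂Φ ω ∂P = c * volume B := by
  have ho := measurable_outMass hΨ hF
  have hm : Measurable fun ω => ∫⁻ x in B, outMass (Ψ ω) (F ω) x ∂Φ ω := by
    simp only [← lintegral_indicator hB]
    refine hΦ.measurable_lintegral measurable_id ?_
    exact ho.indicator (measurable_snd hB)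
  rw [← hc B hB, ← lintegral_add_left hm]
  refine lintegral_congr_ae ?_
  filter_upwards [hle] with ω hω
  have hoω : Measurable fun x => outMass (Ψ ω) (F ω) x :=
    ho.comp (measurable_prodMk_left (x := ω))
  rw [← lintegral_add_left hoω]
  simp only [add_tsub_cancel_of_le (hω _)]
  simp

/-- The deficit of the sites in `B` vanishes in mean if and only if almost surely almost no site in
`B` is unexhausted. -/
theorem lintegral_deficit_eq_zero_iff (hΦ : IsFlowAdaptedMeasure Φ) (hΨ : IsFlowAdaptedMeasure Ψ)
    (hF : IsFlowAdaptedFunction F) (hle : ∀ᵐ ω ∂P, ∀ x, outMass (Ψ ω) (F ω) x ≤ 1)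
    {B : Set (E d)} (hB : MeasurableSet B) :
    ∫⁻ ω, ∫⁻ x in B, (1 - outMass (Ψ ω) (F ω) x) ∂Φ ω ∂P = 0 ↔
      ∀ᵐ ω ∂P, Φ ω (unexhausted (Ψ ω) (F ω) ∩ B) = 0 := by
  have ho : Measurable fun p : Ω × E d => 1 - outMass (Ψ p.1) (F p.1) p.2 :=
    measurable_const.sub (measurable_outMass hΨ hF)
  have hm : Measurable fun ω => ∫⁻ x in B, (1 - outMass (Ψ ω) (F ω) x) ∂Φ ω := by
    simp only [← lintegral_indicator hB]
    refine hΦ.measurable_lintegral measurable_id ?_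
    exact ho.indicator (measurable_snd hB)
  rw [lintegral_eq_zero_iff hm]
  refine Filter.eventually_congr ?_
  filter_upwards [hle] with ω hω
  have hoω : Measurable fun x => 1 - outMass (Ψ ω) (F ω) x :=
    ho.comp (measurable_prodMk_left (x := ω))
  simp only [Pi.zero_apply]
  rw [lintegral_eq_zero_iff hoω,
    ← Measure.restrict_apply (measurableSet_unexhausted hΨ hF ω), Filter.EventuallyEq, ae_iff]
  congr! 2
  ext x
  -- Truncated subtraction only detects `outMass < 1`; the bound `outMass ≤ 1` turns this into `≠
  -- 1`.
  simp only [unexhausted, Set.mem_ofPred_eq, Pi.zero_apply, tsub_eq_zero_iff_le, not_le]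
  exact (hω x).lt_iff_ne

end Flow

/-! ### Stability -/

section Stable

variable {d : ℕ} {φ ψ : Measure (E d)} {f : E d → E d → ℝ}

/-- Stability treats sites and centers alike, so every result on sites also yields one on centers.
-/
theorem IsStableConstrained.swap (hf : IsStableConstrained φ ψ f) :
    IsStableConstrained ψ φ fun ξ x => f x ξ where
  constrained :=
    { subBalancing :=
        { measurable := hf.constrained.subBalancing.measurable.comp measurable_swap
          nonneg := fun x ξ => hf.constrained.subBalancing.nonneg ξ x
          outMass_le := hf.constrained.subBalancing.inMass_le
          inMass_le := hf.constrained.subBalancing.outMass_le }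
      le_one := fun x ξ => hf.constrained.le_one ξ x }
  stable := by
    rintro ⟨ξ, x, ⟨h1, h2⟩, ⟨-, h3⟩⟩
    refine hf.stable ⟨x, ξ, ⟨h1, h3.imp id ?_⟩, ⟨h1, h2.imp id ?_⟩⟩
    · rintro ⟨y, hy, hy'⟩
      exact ⟨y, by simpa only [dist_comm] using hy, hy'⟩
    · rintro ⟨y, hy, hy'⟩
      exact ⟨y, by simpa only [dist_comm] using hy, hy'⟩

/-- If there is an unsated center, the unexhausted sites are all allocated to it to the full
extent, so that their mass is less than one. -/
theorem IsStableConstrained.measure_unexhausted_lt_one (hf : IsStableConstrained φ ψ f)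
    {ξ : E d} (hξ : ξ ∈ unsated φ f) : φ (unexhausted ψ f) < 1 := by
  have hsub : unexhausted ψ f ⊆ {x | 1 ≤ ENNReal.ofReal (f x ξ)} := by
    intro x hx
    -- An unexhausted site and an unsated center would desire each other as soon as `f x ξ < 1`.
    have : ¬ f x ξ < 1 := fun hlt => hf.stable ⟨x, ξ, ⟨hlt, Or.inl hx⟩, ⟨hlt, Or.inl hξ⟩⟩
    simpa using this
  have hm : Measurable fun x => ENNReal.ofReal (f x ξ) :=
    ENNReal.measurable_ofReal.comp
      (hf.constrained.subBalancing.measurable.comp measurable_prodMk_right)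
  calc φ (unexhausted ψ f) ≤ φ {x | 1 ≤ ENNReal.ofReal (f x ξ)} := measure_mono hsub
    _ ≤ inMass φ f ξ := by
      simpa only [one_mul, inMass] using mul_meas_ge_le_lintegral hm 1
    _ < 1 := lt_of_le_of_ne (hf.constrained.subBalancing.inMass_le ξ) hξ

theorem IsStableConstrained.unsated_eq_empty (hf : IsStableConstrained φ ψ f)
    (h : φ (unexhausted ψ f) = ∞) : unsated φ f = ∅ := by
  by_contra hne
  obtain ⟨ξ, hξ⟩ := Set.nonempty_iff_ne_empty.2 hne
  have := hf.measure_unexhausted_lt_one hξ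
  simp [h] at this

end Stable

/-! ### Comparing the intensities of sites and centers -/

section Intensities

variable {d : ℕ} {Ω : Type*} [MeasurableSpace Ω] [AddAction (E d) Ω] [MeasurableVAdd₂ (E d) Ω]
  {P : Measure Ω} {Φ Ψ : Ω → Measure (E d)} {lamΦ lamΨ : ℝ≥0∞} {F : Ω → E d → E d → ℝ}

/-- If almost surely the unexhausted sites carry no mass, then the sites are at most as intense as
the centers. -/
theorem intensity_le_of_ae_measure_unexhausted_eq_zero (hP : IsErgodic d P)
    (hΦ : IsFlowAdaptedMeasure Φ) (hΨ : IsFlowAdaptedMeasure Ψ)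
    (hlamΦ : IsIntensity P Φ lamΦ) (hlamΨ : IsIntensity P Ψ lamΨ)
    (hF : IsFlowAdaptedFunction F)
    (hF_stable : ∀ᵐ ω ∂P, IsStableConstrained (Φ ω) (Ψ ω) (F ω))
    (h : ∀ᵐ ω ∂P, Φ ω (unexhausted (Ψ ω) (F ω)) = 0) : lamΦ ≤ lamΨ := by
  have hB : MeasurableSet (Metric.ball (0 : E d) 1) := measurableSet_ball
  have h0 : volume (Metric.ball (0 : E d) 1) ≠ 0 := (Metric.measure_ball_pos _ _ one_pos).ne'
  have htop : volume (Metric.ball (0 : E d) 1) ≠ ∞ := measure_ball_lt_top.ne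
  have hout : ∀ᵐ ω ∂P, ∀ x, outMass (Ψ ω) (F ω) x ≤ 1 :=
    hF_stable.mono fun ω hω => hω.constrained.subBalancing.outMass_le
  have hin : ∀ᵐ ω ∂P, ∀ ξ, inMass (Φ ω) (F ω) ξ ≤ 1 :=
    hF_stable.mono fun ω hω => hω.constrained.subBalancing.inMass_le
  have e1 := lintegral_outMass_add_deficit hΦ hΨ hF hout hlamΦ hB
  have e2 := lintegral_outMass_add_deficit hΨ hΦ hF.swap hin hlamΨ hB
  rw [(lintegral_deficit_eq_zero_iff hΦ hΨ hF hout hB).2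
    (h.mono fun ω hω => measure_mono_null Set.inter_subset_left hω), add_zero,
    lintegral_outMass_eq_lintegral_inMass hP hΦ hΨ hF hB h0 htop] at e1
  -- All `Φ`-mass in the ball is sent out in mean, so it equals the mean mass received there, which
  -- the intensity of `Ψ` bounds.
  rw [← ENNReal.mul_le_mul_iff_left h0 htop, ← e1, ← e2]
  exact le_self_add

/-- If the sites are more intense than the centers, then almost surely every center is sated, and
the unexhausted sites have infinite mass. -/
theorem ae_unsated_eq_empty_and_measure_unexhausted_eq_top (hd : 1 ≤ d) (hP : IsErgodic d P)
    (hΦ : IsFlowAdaptedMeasure Φ) (hΨ : IsFlowAdaptedMeasure Ψ)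
    (hlamΦ : IsIntensity P Φ lamΦ) (hlamΨ : IsIntensity P Ψ lamΨ)
    (hF : IsFlowAdaptedFunction F)
    (hF_stable : ∀ᵐ ω ∂P, IsStableConstrained (Φ ω) (Ψ ω) (F ω)) (hlt : lamΨ < lamΦ) :
    ∀ᵐ ω ∂P, unsated (Φ ω) (F ω) = ∅ ∧ Φ ω (unexhausted (Ψ ω) (F ω)) = ∞ := by
  rcases ae_measure_unexhausted_eq_zero_or_ae_eq_top hd hP hΦ hΨ hF with h | h
  · exact absurd (intensity_le_of_ae_measure_unexhausted_eq_zero hP hΦ hΨ hlamΦ hlamΨ hF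
      hF_stable h) hlt.not_ge
  · filter_upwards [h, hF_stable] with ω h1 h2
    exact ⟨h2.unsated_eq_empty h1, h1⟩

/-- With equal finite intensities, almost surely almost every site is exhausted. -/
theorem ae_measure_unexhausted_eq_zero_of_intensity_eq (hd : 1 ≤ d) (hP : IsErgodic d P)
    (hΦ : IsFlowAdaptedMeasure Φ) (hΨ : IsFlowAdaptedMeasure Ψ) {c : ℝ≥0∞} (hc : c ≠ ∞)
    (hcΦ : IsIntensity P Φ c) (hcΨ : IsIntensity P Ψ c) (hF : IsFlowAdaptedFunction F)
    (hF_stable : ∀ᵐ ω ∂P, IsStableConstrained (Φ ω) (Ψ ω) (F ω)) :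
    ∀ᵐ ω ∂P, Φ ω (unexhausted (Ψ ω) (F ω)) = 0 := by
  rcases ae_measure_unexhausted_eq_zero_or_ae_eq_top hd hP hΦ hΨ hF with h | h
  · exact h
  have hout : ∀ᵐ ω ∂P, ∀ x, outMass (Ψ ω) (F ω) x ≤ 1 :=
    hF_stable.mono fun ω hω => hω.constrained.subBalancing.outMass_le
  have hin : ∀ᵐ ω ∂P, ∀ ξ, inMass (Φ ω) (F ω) ξ ≤ 1 :=
    hF_stable.mono fun ω hω => hω.constrained.subBalancing.inMass_le
  -- In the case of infinite mass all centers are sated, and the mass balance still forces a null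
  -- set. Balls keep the balance finite, so that it can be cancelled.
  have hball (n : ℕ) :
      ∀ᵐ ω ∂P, Φ ω (unexhausted (Ψ ω) (F ω) ∩ Metric.ball 0 ((n : ℝ) + 1)) = 0 := by
    have hB : MeasurableSet (Metric.ball (0 : E d) ((n : ℝ) + 1)) := measurableSet_ball
    have h0 : volume (Metric.ball (0 : E d) ((n : ℝ) + 1)) ≠ 0 :=
      (Metric.measure_ball_pos _ _ n.cast_add_one_pos).ne'
    have htop : volume (Metric.ball (0 : E d) ((n : ℝ) + 1)) ≠ ∞ := measure_ball_lt_top.ne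
    have e1 := lintegral_outMass_add_deficit hΦ hΨ hF hout hcΦ hB
    have e2 := lintegral_outMass_add_deficit hΨ hΦ hF.swap hin hcΨ hB
    have hnull : ∀ᵐ ω ∂P, Ψ ω (unsated (Φ ω) (F ω) ∩ Metric.ball 0 ((n : ℝ) + 1)) = 0 := by
      filter_upwards [h, hF_stable] with ω h1 h2
      simp [h2.unsated_eq_empty h1]
    rw [(lintegral_deficit_eq_zero_iff hΨ hΦ hF.swap hin hB).2 hnull, add_zero] at e2
    rw [lintegral_outMass_eq_lintegral_inMass hP hΦ hΨ hF hB h0 htop] at e1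
    refine (lintegral_deficit_eq_zero_iff hΦ hΨ hF hout hB).1 ?_
    have hfin : c * volume (Metric.ball (0 : E d) ((n : ℝ) + 1)) ≠ ∞ := ENNReal.mul_ne_top hc htop
    rw [show ∫⁻ ω, ∫⁻ ξ in Metric.ball 0 ((n : ℝ) + 1), inMass (Φ ω) (F ω) ξ ∂Ψ ω ∂P =
      c * volume (Metric.ball (0 : E d) ((n : ℝ) + 1)) from e2] at e1
    exact (ENNReal.add_right_inj hfin).1 (e1.trans (add_zero _).symm)
  filter_upwards [ae_all_iff.2 hball] with ω hω
  refine measure_mono_null (fun x hx => ?_) (measure_iUnion_null hω)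
  obtain ⟨n, hn⟩ := exists_nat_gt ‖x‖
  exact Set.mem_iUnion.2 ⟨n, hx, by simpa using hn.trans (lt_add_one _)⟩

end Intensities

end StableTransport

theorem theorem3p9 {d : ℕ} (hd : 1 ≤ d) {Ω : Type*} [MeasurableSpace Ω]
    [AddAction (E d) Ω] [MeasurableVAdd₂ (E d) Ω]
    (P : Measure Ω) (Φ Ψ : Ω → Measure (E d))
    (hΦ : IsErgodicRandomMeasure P Φ) (hΨ : IsErgodicRandomMeasure P Ψ)
    (lamΦ lamΨ : ℝ≥0∞)
    (hlamΦ : IsIntensity P Φ lamΦ) (hlamΦ_pos : 0 < lamΦ) (hlamΦ_fin : lamΦ < ∞)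
    (hlamΨ : IsIntensity P Ψ lamΨ) (hlamΨ_pos : 0 < lamΨ) (hlamΨ_fin : lamΨ < ∞)
    (F : Ω → E d → E d → ℝ) (hF : IsFlowAdaptedFunction F)
    (hF_stable : ∀ᵐ ω ∂P, IsStableConstrained (Φ ω) (Ψ ω) (F ω)) :
    ∀ᵐ ω ∂P,
      (lamΦ = lamΨ →
        IsBalancing (Φ ω) (Ψ ω) (F ω) ∧
        Φ ω (unexhausted (Ψ ω) (F ω)) = 0 ∧ Ψ ω (unsated (Φ ω) (F ω)) = 0) ∧
      (lamΦ < lamΨ →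
        unexhausted (Ψ ω) (F ω) = ∅ ∧ Ψ ω (unsated (Φ ω) (F ω)) = ∞) ∧
      (lamΨ < lamΦ →
        unsated (Φ ω) (F ω) = ∅ ∧ Φ ω (unexhausted (Ψ ω) (F ω)) = ∞) := by
  have hP := hΦ.ergodic
  have hF_swap : ∀ᵐ ω ∂P, IsStableConstrained (Ψ ω) (Φ ω) fun ξ x => F ω x ξ :=
    hF_stable.mono fun ω hω => hω.swap
  -- The comparisons of intensities do not depend on `ω`, so each case can be treated separately.
  simp only [Filter.eventually_and, Filter.eventually_imp_distrib_left]
  refine ⟨?_, ?_, ?_⟩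
  · rintro rfl
    have h1 := ae_measure_unexhausted_eq_zero_of_intensity_eq hd hP hΦ.flowAdapted
      hΨ.flowAdapted hlamΦ_fin.ne hlamΦ hlamΨ hF hF_stable
    have h2 : ∀ᵐ ω ∂P, Ψ ω (unsated (Φ ω) (F ω)) = 0 :=
      ae_measure_unexhausted_eq_zero_of_intensity_eq hd hP hΨ.flowAdapted
        hΦ.flowAdapted hlamΦ_fin.ne hlamΨ hlamΦ hF.swap hF_swap
    refine ⟨?_, h1, h2⟩
    filter_upwards [h1, h2, hF_stable] with ω h1 h2 h3
    exact ⟨h3.constrained.subBalancing, h1, h2⟩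
  · intro hlt
    exact Filter.eventually_and.1 (ae_unsated_eq_empty_and_measure_unexhausted_eq_top hd hP
      hΨ.flowAdapted hΦ.flowAdapted hlamΨ hlamΦ hF.swap hF_swap hlt)
  · intro hlt
    exact Filter.eventually_and.1 (ae_unsated_eq_empty_and_measure_unexhausted_eq_top hd hP
      hΦ.flowAdapted hΨ.flowAdapted hlamΦ hlamΨ hF hF_stable hlt)
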